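/- For a bounded set $A\subset\mathbb R$ and $\delta>0$ let $N(A,\delta)$ be the minimal number of intervals of length $\delta$ needed to cover $A$. For a nonempty bounded set $E\subset\mathbb R$ define $$\nu_E^\sharp(\alpha)=\limsup_{\delta\to0+}\frac{\log\big(\sup_{\delta\le|I|\le1}|I|^{-\alpha}N(E\cap I,\delta)\big)}{\log(1/\delta)},\qquad \alpha\in\mathbb R,$$ where the supremum is over all intervals $I$ whose length $|I|$ satisfies $\delta\le|I|\le 1$. For $0\le\theta<1$ let $\dim_{\mathrm A,\theta}E$ (the Assouad spectrum of $E$) be the infimum of all $a>0$ for which there is a constant $C$ with $N(E\cap I,\delta)\le C(|I|/\delta)^a$ for all $\delta\in(0,1)$ and all intervals $I$ with $|I|=\delta^\theta$. Put $\nu_E(\theta)=-(1-\theta)\dim_{\mathrm A,\theta}E$ for $0\le\theta<1$ and $\nu_E(1)=0$, and let $\nu_E^*(\alpha)=\sup_{\theta\in[0,1]}\big(\theta\alpha-\nu_E(\theta)\big)$ be its Legendre transform. Then: (i) For every nonempty bounded set $E\subset\mathbb R$ and every $\alpha\in\mathbb R$, the value $\nu_E^\sharp(\alpha)$ is finite and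 $\nu_E^\sharp(\alpha)=\nu_E^*(\alpha)$. (ii) Let $\tau:[0,\infty)\to[0,\infty)$. There is a nonempty bounded set $E\subset\mathbb R$ with $\nu_E^\sharp(\alpha)=\tau(\alpha)$ for all $\alpha\ge0$ if and only if $\tau$ is increasing (that is, $\tau(x)\le\tau(y)$ whenever $0\le x\le y$), convex, and satisfies $\tau(\alpha)=\alpha$ for all $\alpha\ge1$. -/

import Mathlib

open scoped NNReal ENNReal

noncomputable section

namespace LegendreAssouad

/-- The `δ`-covering number `N(A, δ)`: the least number of (closed) intervals of length `δ`,
that is, of closed balls of radius `δ / 2` in `ℝ`, needed to cover `A`. -/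
def coverNum (A : Set ℝ) (δ : ℝ) : ℕ∞ :=
  Metric.externalCoveringNumber (δ / 2).toNNReal A

/-- The supremum of `|I| ^ (-α) * N(E ∩ I, δ)` over all intervals `I` with `δ ≤ |I| ≤ 1`.
As `N` is monotone in the set, it is enough to range over the closed intervals
`I = [x, x + l]`. -/
def weightedSup (E : Set ℝ) (α δ : ℝ) : ℝ≥0∞ :=
  ⨆ (l : ℝ) (_ : δ ≤ l ∧ l ≤ 1) (x : ℝ),
    ENNReal.ofReal (l ^ (-α)) * (coverNum (E ∩ Set.Icc x (x + l)) δ : ℝ≥0∞)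

/-- The Legendre-Assouad function `ν_E^♯`, as an extended real number. -/
def nuSharp (E : Set ℝ) (α : ℝ) : EReal :=
  Filter.limsup (fun δ : ℝ => ENNReal.log (weightedSup E α δ) / ((Real.log (1 / δ) : ℝ) : EReal))
    (nhdsWithin 0 (Set.Ioi 0))

/-- The Assouad spectrum `dim_{A,θ} E`: the infimum of all exponents `a > 0` for which there is a
constant `C` with `N(E ∩ I, δ) ≤ C (|I| / δ) ^ a` for all `δ ∈ (0, 1)` and all intervals `I` with
`|I| = δ ^ θ`. It is meant for `0 ≤ θ < 1`. -/
def assouadSpectrum (E : Set ℝ) (θ : ℝ) : ℝ :=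
  sInf {a : ℝ | 0 < a ∧ ∃ C : ℝ, ∀ δ : ℝ, 0 < δ → δ < 1 → ∀ x : ℝ,
    (coverNum (E ∩ Set.Icc x (x + δ ^ θ)) δ : ℝ≥0∞) ≤ ENNReal.ofReal (C * (δ ^ θ / δ) ^ a)}

/-- `ν_E(θ) = -(1 - θ) dim_{A,θ} E` for `θ ∈ [0, 1]`. At `θ = 1` the factor `1 - θ` vanishes, so
`ν_E(1) = 0` whatever the value given to `dim_{A,1} E`. -/
def nu (E : Set ℝ) (θ : ℝ) : ℝ :=
  -(1 - θ) * assouadSpectrum E θ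

/-- The Legendre transform of a function `ν` on `I ⊆ ℝ`, as an extended real number. -/
def legendreTransform (I : Set ℝ) (ν : ℝ → ℝ) (α : ℝ) : EReal :=
  ⨆ θ ∈ I, ((θ * α - ν θ : ℝ) : EReal)

end LegendreAssouad

end

namespace LegendreAssouad

open Filter Topology Set

/-! ### Covering numbers -/

lemma coverNum_mono {A B : Set ℝ} (h : A ⊆ B) (δ : ℝ) : coverNum A δ ≤ coverNum B δ :=
  Metric.externalCoveringNumber_mono_set h

lemma coverNum_anti (A : Set ℝ) {δ δ' : ℝ} (h : δ ≤ δ') : coverNum A δ' ≤ coverNum A δ :=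
  Metric.externalCoveringNumber_anti (Real.toNNReal_le_toNNReal (by linarith))

lemma one_le_coverNum {A : Set ℝ} (h : A.Nonempty) (δ : ℝ) : 1 ≤ coverNum A δ :=
  Order.one_le_iff_pos.2 (Metric.externalCoveringNumber_pos_iff.2 h)

/-- A set covered by the intervals `[c, c + δ]`, `c ∈ C`, has `δ`-covering number at most `#C`. -/
lemma coverNum_le_card {A : Set ℝ} {δ : ℝ} (hδ : 0 ≤ δ) (C : Finset ℝ)
    (h : ∀ x ∈ A, ∃ c ∈ C, c ≤ x ∧ x ≤ c + δ) : coverNum A δ ≤ C.card := by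
  have hcov : Metric.IsCover (δ / 2).toNNReal A
      ((C.image fun c => c + δ / 2 : Finset ℝ) : Set ℝ) := by
    rw [Metric.isCover_iff_subset_iUnion_closedBall]
    intro x hx
    obtain ⟨c, hc, h1, h2⟩ := h x hx
    simp only [mem_iUnion]
    refine ⟨c + δ / 2, by simpa using hc, ?_⟩
    rw [Metric.mem_closedBall, Real.coe_toNNReal _ (by linarith), Real.dist_eq, abs_le]
    constructor <;> linarith
  refine hcov.externalCoveringNumber_le_encard.trans ?_
  rw [Set.encard_coe_eq_coe_finsetCard]
  exact_mod_cast Finset.card_image_le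

lemma coverNum_Icc_le (E : Set ℝ) {δ l : ℝ} (hδ : 0 < δ) (hl : δ ≤ l) (x : ℝ) :
    (coverNum (E ∩ Icc x (x + l)) δ : ℝ≥0∞) ≤ ENNReal.ofReal (2 * (l / δ)) := by
  have hle : coverNum (E ∩ Icc x (x + l)) δ ≤ ((⌊l / δ⌋₊ + 1 : ℕ) : ℕ∞) := by
    refine (coverNum_le_card hδ.le
      ((Finset.range (⌊l / δ⌋₊ + 1)).image fun k : ℕ => x + k * δ) ?_).trans ?_
    · rintro y ⟨-, hy1, hy2⟩
      have h0 : 0 ≤ (y - x) / δ := div_nonneg (by linarith) hδ.le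
      refine ⟨x + ⌊(y - x) / δ⌋₊ * δ, ?_, ?_, ?_⟩
      · refine Finset.mem_image.2 ⟨_, Finset.mem_range.2 (Nat.lt_succ_of_le ?_), rfl⟩
        exact Nat.floor_le_floor (by gcongr; linarith)
      · have := Nat.floor_le h0
        rw [le_div_iff₀ hδ] at this
        linarith
      · have := (Nat.lt_floor_add_one ((y - x) / δ)).le
        rw [div_le_iff₀ hδ] at this
        linarith
    · exact_mod_cast Finset.card_image_le.trans (by simp)
  have h1 : (1 : ℝ) ≤ l / δ := (one_le_div hδ).2 hl
  calc (coverNum (E ∩ Icc x (x + l)) δ : ℝ≥0∞)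
      ≤ ((((⌊l / δ⌋₊ + 1 : ℕ) : ℕ∞)) : ℝ≥0∞) := by exact_mod_cast hle
    _ = ENNReal.ofReal ((⌊l / δ⌋₊ + 1 : ℕ) : ℝ) := by
        rw [ENNReal.ofReal_natCast, ENat.toENNReal_coe]
    _ ≤ ENNReal.ofReal (2 * (l / δ)) := by
        apply ENNReal.ofReal_le_ofReal
        have := Nat.floor_le (zero_le_one.trans h1)
        push_cast
        linarith

/-! ### Growth exponents -/

lemma le_weightedSup (E : Set ℝ) (α : ℝ) {δ l : ℝ} (h1 : δ ≤ l) (h2 : l ≤ 1) (x : ℝ) :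
    ENNReal.ofReal (l ^ (-α)) * (coverNum (E ∩ Icc x (x + l)) δ : ℝ≥0∞) ≤ weightedSup E α δ :=
  le_iSup_of_le l (le_iSup₂_of_le ⟨h1, h2⟩ x le_rfl)

lemma tendsto_log_one_div : Tendsto (fun δ : ℝ => Real.log (1 / δ)) (𝓝[>] 0) atTop := by
  simp only [one_div]
  exact Real.tendsto_log_atTop.comp tendsto_inv_nhdsGT_zero

lemma eventually_mem_Ioo_zero_one : ∀ᶠ δ : ℝ in 𝓝[>] 0, δ ∈ Ioo (0 : ℝ) 1 :=
  Ioo_mem_nhdsGT one_pos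

lemma log_div_log_eq {C s δ : ℝ} (hC : 0 < C) (hδ : δ ∈ Ioo (0 : ℝ) 1) :
    ENNReal.log (ENNReal.ofReal (C * δ ^ (-s))) / ((Real.log (1 / δ) : ℝ) : EReal)
      = ((s + Real.log C / Real.log (1 / δ) : ℝ) : EReal) := by
  have hp : 0 < δ ^ (-s) := Real.rpow_pos_of_pos hδ.1 _
  have hl : Real.log δ ≠ 0 := (Real.log_neg hδ.1 hδ.2).ne
  rw [ENNReal.log_ofReal_of_pos (mul_pos hC hp), ← EReal.coe_div, EReal.coe_eq_coe_iff,
    Real.log_mul hC.ne' hp.ne', Real.log_rpow hδ.1, one_div, Real.log_inv]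
  field_simp
  ring

lemma tendsto_exponent (C s : ℝ) :
    Tendsto (fun δ : ℝ => ((s + Real.log C / Real.log (1 / δ) : ℝ) : EReal)) (𝓝[>] 0)
      (𝓝 (s : EReal)) := by
  refine (continuous_coe_real_ereal.tendsto s).comp ?_
  simpa using (tendsto_const_nhds (x := s)).add
    ((tendsto_const_nhds (x := Real.log C)).div_atTop tendsto_log_one_div)

lemma log_one_div_nonneg {δ : ℝ} (hδ : δ ∈ Ioo (0 : ℝ) 1) :
    (0 : EReal) ≤ ((Real.log (1 / δ) : ℝ) : EReal) := by
  exact_mod_cast Real.log_nonneg ((one_le_div hδ.1).2 hδ.2.le)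

lemma nuSharp_le {E : Set ℝ} {α s C : ℝ}
    (h : ∀ᶠ δ in 𝓝[>] (0 : ℝ), weightedSup E α δ ≤ ENNReal.ofReal (C * δ ^ (-s))) :
    nuSharp E α ≤ (s : EReal) := by
  rw [← (tendsto_exponent (max C 1) s).limsup_eq]
  refine limsup_le_limsup ?_
  filter_upwards [h, eventually_mem_Ioo_zero_one] with δ h hδ
  have hp : 0 < δ ^ (-s) := Real.rpow_pos_of_pos hδ.1 _
  rw [← log_div_log_eq (by positivity) hδ]
  refine EReal.div_le_div_right_of_nonneg (log_one_div_nonneg hδ) (ENNReal.log_monotone ?_)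
  refine h.trans (ENNReal.ofReal_le_ofReal ?_)
  gcongr
  exact le_max_left _ _

lemma le_nuSharp {E : Set ℝ} {α s c : ℝ} (hc : 0 < c)
    (h : ∃ᶠ δ in 𝓝[>] (0 : ℝ), ENNReal.ofReal (c * δ ^ (-s)) ≤ weightedSup E α δ) :
    (s : EReal) ≤ nuSharp E α := by
  refine EReal.ge_of_forall_gt_iff_ge.1 fun r hr => ?_
  refine le_limsup_of_frequently_le ?_
  refine (h.and_eventually (((tendsto_exponent c s).eventually_const_lt hr).and
    eventually_mem_Ioo_zero_one)).mono ?_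
  rintro δ ⟨h, hr, hδ⟩
  refine hr.le.trans ?_
  rw [← log_div_log_eq hc hδ]
  exact EReal.div_le_div_right_of_nonneg (log_one_div_nonneg hδ) (ENNReal.log_monotone h)

/-! ### The Assouad spectrum -/

/-- The exponents `a` admissible in the definition of the Assouad spectrum. -/
def spectrumExponents (E : Set ℝ) (θ : ℝ) : Set ℝ :=
  {a : ℝ | 0 < a ∧ ∃ C : ℝ, ∀ δ : ℝ, 0 < δ → δ < 1 → ∀ x : ℝ,
    (coverNum (E ∩ Icc x (x + δ ^ θ)) δ : ℝ≥0∞) ≤ ENNReal.ofReal (C * (δ ^ θ / δ) ^ a)}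

lemma assouadSpectrum_eq (E : Set ℝ) (θ : ℝ) :
    assouadSpectrum E θ = sInf (spectrumExponents E θ) := rfl

lemma bddBelow_spectrumExponents (E : Set ℝ) (θ : ℝ) : BddBelow (spectrumExponents E θ) :=
  ⟨0, fun _ h => h.1.le⟩

lemma le_rpow_of_le_one {δ θ : ℝ} (hδ : δ ∈ Ioo (0 : ℝ) 1) (hθ : θ ≤ 1) : δ ≤ δ ^ θ := by
  simpa using Real.rpow_le_rpow_of_exponent_ge hδ.1 hδ.2.le hθ

lemma one_mem_spectrumExponents (E : Set ℝ) {θ : ℝ} (hθ : θ ≤ 1) :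
    1 ∈ spectrumExponents E θ := by
  refine ⟨one_pos, 2, fun δ h0 h1 x => ?_⟩
  rw [Real.rpow_one]
  exact coverNum_Icc_le E h0 (le_rpow_of_le_one ⟨h0, h1⟩ hθ) x

lemma assouadSpectrum_le_one (E : Set ℝ) {θ : ℝ} (hθ : θ ≤ 1) : assouadSpectrum E θ ≤ 1 :=
  csInf_le (bddBelow_spectrumExponents E θ) (one_mem_spectrumExponents E hθ)

lemma rpow_div_self_rpow {δ : ℝ} (hδ : 0 < δ) (θ a : ℝ) :
    (δ ^ θ / δ) ^ a = δ ^ (-((1 - θ) * a)) := by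
  nth_rewrite 2 [← Real.rpow_one δ]
  rw [← Real.rpow_sub hδ, ← Real.rpow_mul hδ.le]
  ring_nf

lemma exists_coverNum_le_of_assouadSpectrum_lt (E : Set ℝ) {θ a : ℝ} (hθ : θ ≤ 1)
    (ha : assouadSpectrum E θ < a) :
    ∃ C : ℝ, 0 ≤ C ∧ ∀ δ ∈ Ioo (0 : ℝ) 1, ∀ x : ℝ,
      (coverNum (E ∩ Icc x (x + δ ^ θ)) δ : ℝ≥0∞)
        ≤ ENNReal.ofReal (C * δ ^ (-((1 - θ) * a))) := by
  obtain ⟨a', ⟨-, C, hC⟩, h'⟩ := exists_lt_of_csInf_lt ⟨1, one_mem_spectrumExponents E hθ⟩ ha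
  refine ⟨max C 0, le_max_right _ _, fun δ hδ x => (hC δ hδ.1 hδ.2 x).trans ?_⟩
  apply ENNReal.ofReal_le_ofReal
  have hp : 0 < δ ^ (-((1 - θ) * a')) := Real.rpow_pos_of_pos hδ.1 _
  rw [rpow_div_self_rpow hδ.1]
  refine mul_le_mul (le_max_left _ _) ?_ hp.le (le_max_right _ _)
  exact Real.rpow_le_rpow_of_exponent_ge hδ.1 hδ.2.le (by nlinarith)

/-! ### The Legendre transform formula -/

lemma exists_grid_point {n : ℕ} (hn : 0 < n) {t : ℝ} (h0 : 0 ≤ t) (h1 : t ≤ 1) :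
    ∃ k ∈ Finset.range n, (k : ℝ) / n ≤ t ∧ t ≤ (k : ℝ) / n + 1 / n := by
  have hn' : (0 : ℝ) < n := by exact_mod_cast hn
  rcases h1.lt_or_eq with h1 | rfl
  · refine ⟨⌊t * n⌋₊, ?_, ?_, ?_⟩
    · rw [Finset.mem_range, Nat.floor_lt (by positivity)]
      nlinarith
    · rw [div_le_iff₀ hn']
      exact Nat.floor_le (by positivity)
    · rw [← add_div, le_div_iff₀ hn']
      exact (Nat.lt_floor_add_one _).le
  · refine ⟨n - 1, Finset.mem_range.2 (by omega), ?_, ?_⟩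
    · rw [div_le_one hn']
      exact_mod_cast Nat.sub_le n 1
    · rw [← add_div, le_div_iff₀ hn', Nat.cast_sub hn]
      simp

lemma nuSharp_le_add_of_forall_le (E : Set ℝ) {α r ε : ℝ} (hε : 0 < ε)
    (h : ∀ θ ∈ Icc (0 : ℝ) 1, θ * α + (1 - θ) * assouadSpectrum E θ ≤ r) :
    nuSharp E α ≤ ((r + ε : ℝ) : EReal) := by
  obtain ⟨n, hn⟩ := exists_nat_gt (|α| / (ε / 2))
  have hn' : (0 : ℝ) < n := lt_of_le_of_lt (by positivity) hn
  have hn0 : 0 < n := by exact_mod_cast hn'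
  have hαn : |α| * (1 / n) ≤ ε / 2 := by
    rw [div_lt_iff₀ (by positivity)] at hn
    rw [mul_one_div, div_le_iff₀ hn']
    linarith
  have hgrid : ∀ k ∈ Finset.range n, (k : ℝ) / n ∈ Icc (0 : ℝ) 1 := fun k hk =>
    ⟨by positivity, (div_le_one hn').2 (by exact_mod_cast (Finset.mem_range.1 hk).le)⟩
  have hC : ∀ k ∈ Finset.range n, ∃ C : ℝ, 0 ≤ C ∧ ∀ δ ∈ Ioo (0 : ℝ) 1, ∀ x : ℝ,
      (coverNum (E ∩ Icc x (x + δ ^ ((k : ℝ) / n))) δ : ℝ≥0∞)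
        ≤ ENNReal.ofReal (C * δ ^ (-((1 - (k : ℝ) / n) *
            (assouadSpectrum E ((k : ℝ) / n) + ε / 2)))) := fun k hk =>
    exists_coverNum_le_of_assouadSpectrum_lt E (hgrid k hk).2 (by linarith)
  choose! C hC0 hC using hC
  refine nuSharp_le (C := ∑ k ∈ Finset.range n, C k) ?_
  filter_upwards [eventually_mem_Ioo_zero_one] with δ hδ
  refine iSup_le fun l => iSup₂_le fun hl x => ?_
  have hl0 : 0 < l := hδ.1.trans_le hl.1
  have hlogδ : Real.log δ < 0 := Real.log_neg hδ.1 hδ.2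
  obtain ⟨t, rfl⟩ : ∃ t, δ ^ t = l := ⟨Real.log l / Real.log δ, by
    rw [Real.rpow_def_of_pos hδ.1, mul_div_cancel₀ _ hlogδ.ne, Real.exp_log hl0]⟩
  have ht0 : 0 ≤ t := (Real.rpow_le_one_iff_of_pos hδ.1).1 hl.2 |>.elim
    (fun h => absurd h.1 (not_le.2 hδ.2)) (fun h => h.2)
  have ht1 : t ≤ 1 := by
    have := hl.1
    nth_rewrite 1 [← Real.rpow_one δ] at this
    exact (Real.rpow_le_rpow_left_iff_of_base_lt_one hδ.1 hδ.2).1 this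
  obtain ⟨k, hk, hkt, htk⟩ := exists_grid_point hn0 ht0 ht1
  have hθ := hgrid k hk
  have hr := h _ hθ
  have hC0k := hC0 k hk
  have hCk := hC k hk δ hδ x
  set θ : ℝ := (k : ℝ) / n with hθ_def
  have hsub : E ∩ Icc x (x + δ ^ t) ⊆ E ∩ Icc x (x + δ ^ θ) :=
    inter_subset_inter_right _ (Icc_subset_Icc_right (by
      linarith [Real.rpow_le_rpow_of_exponent_ge hδ.1 hδ.2.le hkt]))
  have hcov : (coverNum (E ∩ Icc x (x + δ ^ t)) δ : ℝ≥0∞) ≤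
      ENNReal.ofReal (C k * δ ^ (-((1 - θ) * (assouadSpectrum E θ + ε / 2)))) :=
    (by exact_mod_cast coverNum_mono hsub δ : _ ≤ _).trans hCk
  refine (mul_le_mul_right hcov _).trans ?_
  rw [← ENNReal.ofReal_mul (by positivity)]
  apply ENNReal.ofReal_le_ofReal
  have hexp : (δ ^ t) ^ (-α) * (C k * δ ^ (-((1 - θ) * (assouadSpectrum E θ + ε / 2))))
      = C k * δ ^ (-(t * α) + -((1 - θ) * (assouadSpectrum E θ + ε / 2))) := by
    rw [← Real.rpow_mul hδ.1.le, Real.rpow_add hδ.1, mul_neg]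
    ring
  rw [hexp]
  refine mul_le_mul (Finset.single_le_sum (f := C) (fun i hi => hC0 i hi) hk) ?_
    (Real.rpow_pos_of_pos hδ.1 _).le (Finset.sum_nonneg hC0)
  refine Real.rpow_le_rpow_of_exponent_ge hδ.1 hδ.2.le ?_
  have h1 : (t - θ) * α ≤ |α| * (1 / n) :=
    calc (t - θ) * α ≤ (t - θ) * |α| :=
          mul_le_mul_of_nonneg_left (le_abs_self α) (by linarith)
      _ ≤ (1 / n) * |α| := mul_le_mul_of_nonneg_right (by linarith) (abs_nonneg α)
      _ = |α| * (1 / n) := mul_comm _ _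
  have h2 : (1 - θ) * (ε / 2) ≤ ε / 2 := by nlinarith [hθ.1]
  linarith

lemma mul_le_nuSharp {E : Set ℝ} (hE : E.Nonempty) (α : ℝ) {θ : ℝ} (hθ : θ ∈ Icc (0 : ℝ) 1) :
    ((θ * α : ℝ) : EReal) ≤ nuSharp E α := by
  obtain ⟨x, hx⟩ := hE
  refine le_nuSharp one_pos (Eventually.frequently ?_)
  filter_upwards [eventually_mem_Ioo_zero_one] with δ hδ
  have hpos : 0 < δ ^ θ := Real.rpow_pos_of_pos hδ.1 _
  have hne : (E ∩ Icc x (x + δ ^ θ)).Nonempty := ⟨x, hx, le_rfl, by linarith⟩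
  refine le_trans ?_ (le_weightedSup E α (le_rpow_of_le_one hδ hθ.2)
    (Real.rpow_le_one hδ.1.le hδ.2.le hθ.1) x)
  rw [one_mul, ← Real.rpow_mul hδ.1.le, mul_neg]
  refine le_mul_of_one_le_right' ?_
  exact_mod_cast one_le_coverNum hne δ

lemma le_nuSharp_of_lt {E : Set ℝ} {α θ r : ℝ} (hθ : θ ∈ Ico (0 : ℝ) 1) (hr : θ * α < r)
    (h : r < θ * α + (1 - θ) * assouadSpectrum E θ) : (r : EReal) ≤ nuSharp E α := by
  refine le_nuSharp one_pos ?_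
  by_contra hcon
  rw [not_frequently] at hcon
  obtain ⟨δ₀, hδ₀, hsub⟩ := (mem_nhdsGT_iff_exists_Ioo_subset).1 hcon
  have hδ₀' : (0 : ℝ) < δ₀ := hδ₀
  have h1θ : 0 < 1 - θ := by linarith [hθ.2]
  set a := (r - θ * α) / (1 - θ) with ha_def
  have ha : (1 - θ) * a = r - θ * α := by rw [ha_def]; field_simp
  have ha0 : 0 < a := div_pos (by linarith) h1θ
  have hmem : a ∈ spectrumExponents E θ := by
    refine ⟨ha0, max 1 (2 / δ₀), fun δ h0 h1 x => ?_⟩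
    have hδ : δ ∈ Ioo (0 : ℝ) 1 := ⟨h0, h1⟩
    have hle : δ ≤ δ ^ θ := le_rpow_of_le_one hδ hθ.2.le
    have hle1 : δ ^ θ ≤ 1 := Real.rpow_le_one h0.le h1.le hθ.1
    have hone : 1 ≤ (δ ^ θ / δ) ^ a :=
      Real.one_le_rpow ((one_le_div h0).2 hle) ha0.le
    rcases lt_or_ge δ δ₀ with hlt | hge
    · have hW : ¬ ENNReal.ofReal (1 * δ ^ (-r)) ≤ weightedSup E α δ := hsub ⟨h0, hlt⟩
      have hcov := (le_weightedSup E α hle hle1 x).trans (not_le.1 hW).le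
      have hA : 0 < (δ ^ θ) ^ (-α) := by positivity
      rw [mul_comm, ← ENNReal.le_div_iff_mul_le (Or.inl (by simpa using hA))
        (Or.inl ENNReal.ofReal_ne_top), ← ENNReal.ofReal_div_of_pos hA] at hcov
      refine hcov.trans (ENNReal.ofReal_le_ofReal ?_)
      rw [rpow_div_self_rpow h0, ha, ← Real.rpow_mul h0.le, one_mul, ← Real.rpow_sub h0]
      have : -r - θ * -α = -(r - θ * α) := by ring
      rw [this]
      exact le_mul_of_one_le_left (Real.rpow_pos_of_pos h0 _).le (le_max_left _ _)
    · refine (coverNum_Icc_le E h0 hle x).trans (ENNReal.ofReal_le_ofReal ?_)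
      calc 2 * (δ ^ θ / δ) ≤ 2 * (1 / δ₀) := by gcongr
        _ = 2 / δ₀ := by ring
        _ ≤ max 1 (2 / δ₀) * 1 := by rw [mul_one]; exact le_max_right _ _
        _ ≤ max 1 (2 / δ₀) * (δ ^ θ / δ) ^ a := by gcongr
  have := csInf_le (bddBelow_spectrumExponents E θ) hmem
  rw [← assouadSpectrum_eq] at this
  nlinarith

lemma le_nuSharp_of_mem_Icc {E : Set ℝ} (hE : E.Nonempty) (α : ℝ) {θ : ℝ}
    (hθ : θ ∈ Icc (0 : ℝ) 1) : ((θ * α - nu E θ : ℝ) : EReal) ≤ nuSharp E α := by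
  refine EReal.ge_of_forall_gt_iff_ge.1 fun r hr => ?_
  have hr : r < θ * α - nu E θ := by exact_mod_cast hr
  rcases le_or_gt r (θ * α) with h | h
  · exact le_trans (by exact_mod_cast h) (mul_le_nuSharp hE α hθ)
  · rcases hθ.2.lt_or_eq with h1 | rfl
    · exact le_nuSharp_of_lt ⟨hθ.1, h1⟩ h (by unfold nu at hr; linarith)
    · simp [nu] at hr h
      linarith

theorem nuSharp_eq_legendreTransform {E : Set ℝ} (hE : E.Nonempty) (α : ℝ) :
    nuSharp E α = legendreTransform (Icc 0 1) (nu E) α := by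
  refine le_antisymm ?_ (iSup₂_le fun θ hθ => le_nuSharp_of_mem_Icc hE α hθ)
  refine EReal.le_of_forall_lt_iff_le.1 fun r hr => ?_
  obtain ⟨r', h1, h2⟩ := EReal.lt_iff_exists_real_btwn.1 hr
  have h2 : r' < r := by exact_mod_cast h2
  have := nuSharp_le_add_of_forall_le E (α := α) (r := r') (sub_pos.2 h2) (fun θ hθ => by
    have := (le_iSup₂ (f := fun (θ : ℝ) (_ : θ ∈ Icc (0 : ℝ) 1) =>
      ((θ * α - nu E θ : ℝ) : EReal)) θ hθ).trans h1.le
    have : θ * α - nu E θ ≤ r' := by exact_mod_cast this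
    unfold nu at this
    linarith)
  simpa using this

lemma le_legendreTransform (E : Set ℝ) (α : ℝ) {θ : ℝ} (hθ : θ ∈ Icc (0 : ℝ) 1) :
    ((θ * α - nu E θ : ℝ) : EReal) ≤ legendreTransform (Icc 0 1) (nu E) α :=
  le_iSup₂ (f := fun (θ : ℝ) (_ : θ ∈ Icc (0 : ℝ) 1) => ((θ * α - nu E θ : ℝ) : EReal)) θ hθ

lemma legendreTransform_le {E : Set ℝ} {α r : ℝ}
    (h : ∀ θ ∈ Icc (0 : ℝ) 1, θ * α - nu E θ ≤ r) :
    legendreTransform (Icc 0 1) (nu E) α ≤ (r : EReal) :=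
  iSup₂_le fun θ hθ => by exact_mod_cast h θ hθ

lemma neg_nu_le (E : Set ℝ) {θ : ℝ} (hθ : θ ∈ Icc (0 : ℝ) 1) : -nu E θ ≤ 1 - θ := by
  have := assouadSpectrum_le_one E hθ.2
  unfold nu
  nlinarith [hθ.2]

theorem nuSharp_ne_bot_top {E : Set ℝ} (hE : E.Nonempty) (α : ℝ) :
    nuSharp E α ≠ ⊥ ∧ nuSharp E α ≠ ⊤ := by
  rw [nuSharp_eq_legendreTransform hE]
  constructor
  · exact ne_bot_of_le_ne_bot (EReal.coe_ne_bot _) (le_legendreTransform E α ⟨zero_le_one, le_rfl⟩)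
  · refine ne_top_of_le_ne_top (EReal.coe_ne_top (|α| + 1)) (legendreTransform_le fun θ hθ => ?_)
    have h1 := neg_nu_le E hθ
    have h2 : θ * α ≤ θ * |α| := mul_le_mul_of_nonneg_left (le_abs_self α) hθ.1
    have h3 : θ * |α| ≤ 1 * |α| := mul_le_mul_of_nonneg_right hθ.2 (abs_nonneg α)
    linarith [hθ.1]

/-! ### Necessary conditions -/

section Necessary

variable {E : Set ℝ} {τ : ℝ≥0 → ℝ≥0}

lemma line_le_of_nuSharp_eq (hE : E.Nonempty)
    (h : ∀ α : ℝ≥0, nuSharp E (α : ℝ) = ((τ α : ℝ) : EReal)) (α : ℝ≥0) {θ : ℝ}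
    (hθ : θ ∈ Icc (0 : ℝ) 1) : θ * α - nu E θ ≤ τ α := by
  have := le_nuSharp_of_mem_Icc hE (α : ℝ) hθ
  rw [h α] at this
  exact_mod_cast this

lemma le_of_forall_line_le (hE : E.Nonempty)
    (h : ∀ α : ℝ≥0, nuSharp E (α : ℝ) = ((τ α : ℝ) : EReal)) (α : ℝ≥0) {r : ℝ}
    (hr : ∀ θ ∈ Icc (0 : ℝ) 1, θ * α - nu E θ ≤ r) : (τ α : ℝ) ≤ r := by
  have := legendreTransform_le hr
  rw [← nuSharp_eq_legendreTransform hE, h α] at this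
  exact_mod_cast this

theorem monotone_of_nuSharp_eq (hE : E.Nonempty)
    (h : ∀ α : ℝ≥0, nuSharp E (α : ℝ) = ((τ α : ℝ) : EReal)) : Monotone τ := by
  intro α β hαβ
  have hαβ' : (α : ℝ) ≤ β := by exact_mod_cast hαβ
  refine NNReal.coe_le_coe.1 (le_of_forall_line_le hE h α fun θ hθ => ?_)
  have := line_le_of_nuSharp_eq hE h β hθ
  nlinarith [hθ.1]

theorem convexOn_of_nuSharp_eq (hE : E.Nonempty)
    (h : ∀ α : ℝ≥0, nuSharp E (α : ℝ) = ((τ α : ℝ) : EReal)) : ConvexOn ℝ≥0 univ τ := by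
  refine ⟨convex_univ, fun x _ y _ a b _ _ hab => ?_⟩
  rw [← NNReal.coe_le_coe]
  have hab' : (a : ℝ) + b = 1 := by exact_mod_cast hab
  refine le_of_forall_line_le hE h _ fun θ hθ => ?_
  have h1 := mul_le_mul_of_nonneg_left (line_le_of_nuSharp_eq hE h x hθ) a.2
  have h2 := mul_le_mul_of_nonneg_left (line_le_of_nuSharp_eq hE h y hθ) b.2
  have h3 : nu E θ = (a + b) * nu E θ := by rw [hab', one_mul]
  simp only [smul_eq_mul, NNReal.coe_add, NNReal.coe_mul]
  simp only [NNReal.val_eq_coe] at h1 h2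
  rw [h3]
  linarith

theorem eq_self_of_nuSharp_eq (hE : E.Nonempty)
    (h : ∀ α : ℝ≥0, nuSharp E (α : ℝ) = ((τ α : ℝ) : EReal)) {α : ℝ≥0} (hα : 1 ≤ α) :
    τ α = α := by
  have hα' : (1 : ℝ) ≤ α := by exact_mod_cast hα
  refine le_antisymm (NNReal.coe_le_coe.1 (le_of_forall_line_le hE h α fun θ hθ => ?_))
    (NNReal.coe_le_coe.1 ?_)
  · have := neg_nu_le E hθ
    nlinarith [hθ.2]
  · simpa [nu] using line_le_of_nuSharp_eq hE h α (θ := 1) ⟨zero_le_one, le_rfl⟩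

end Necessary

/-! ### Sets with prescribed free binary digits -/

/-- The dyadic rationals `2 ^ (-b) * ∑ k ∈ T, 2 ^ k` with `T ⊆ S`. -/
def digitSet (b : ℕ) (S : Finset ℕ) : Set ℝ :=
  Set.image (fun T : Finset ℕ => ((∑ k ∈ T, 2 ^ k : ℕ) : ℝ) / 2 ^ b) (S.powerset : Set (Finset ℕ))

lemma sum_two_pow_mul_le {b j : ℕ} {T : Finset ℕ} (h : ∀ k ∈ T, k + j < b) :
    (∑ k ∈ T, 2 ^ k) * 2 ^ j ≤ 2 ^ b := by
  rcases T.eq_empty_or_nonempty with rfl | ⟨k₀, hk₀⟩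
  · simp
  · have hj : j ≤ b := by have := h k₀ hk₀; omega
    have := Nat.geomSum_lt (m := 2) le_rfl (s := T) (n := b - j)
      (fun k hk => by have := h k hk; omega)
    calc (∑ k ∈ T, 2 ^ k) * 2 ^ j ≤ 2 ^ (b - j) * 2 ^ j := by gcongr
      _ = 2 ^ b := by rw [← pow_add, Nat.sub_add_cancel hj]

lemma sum_two_pow_div_le {b j : ℕ} {T : Finset ℕ} (h : ∀ k ∈ T, k + j < b) :
    ((∑ k ∈ T, 2 ^ k : ℕ) : ℝ) / 2 ^ b ≤ 1 / 2 ^ j := by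
  rw [div_le_div_iff₀ (by positivity) (by positivity), one_mul]
  exact_mod_cast sum_two_pow_mul_le h

lemma exists_sum_two_pow_div_eq {b i : ℕ} {T : Finset ℕ} (h : ∀ k ∈ T, b ≤ k + i) :
    ∃ q : ℤ, ((∑ k ∈ T, 2 ^ k : ℕ) : ℝ) / 2 ^ b = q / 2 ^ i := by
  refine ⟨∑ k ∈ T, 2 ^ (k + i - b), ?_⟩
  push_cast
  rw [Finset.sum_div, Finset.sum_div]
  refine Finset.sum_congr rfl fun k hk => ?_
  rw [div_eq_div_iff (by positivity) (by positivity), ← pow_add, ← pow_add,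
    Nat.sub_add_cancel (h k hk)]

/-- At scale `2 ^ (-j)`, the part of `digitSet b S` in an interval of length `2 ^ (-i)` is governed
by the free digits at the places between `i` and `j`. -/
lemma exists_cover_digitSet (b : ℕ) (S : Finset ℕ) (i j : ℕ) (x : ℝ) :
    ∃ C : Finset ℝ, C.card ≤ 3 * 2 ^ (S.filter fun k => b ≤ k + j ∧ k + i < b).card ∧
      ∀ y ∈ digitSet b S, y ∈ Icc x (x + 1 / 2 ^ i) → ∃ c ∈ C, c ≤ y ∧ y ≤ c + 1 / 2 ^ j := by
  set z : ℤ := ⌈2 ^ i * x - 1⌉ with hz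
  refine ⟨((Finset.Icc z (z + 2)) ×ˢ
    (S.filter fun k => b ≤ k + j ∧ k + i < b).powerset).image
      (fun p => (p.1 : ℝ) / 2 ^ i + ((∑ k ∈ p.2, 2 ^ k : ℕ) : ℝ) / 2 ^ b), ?_, ?_⟩
  · refine Finset.card_image_le.trans ?_
    rw [Finset.card_product, Finset.card_powerset, Int.card_Icc]
    gcongr
    omega
  · rintro y ⟨T, hT, rfl⟩ ⟨hy1, hy2⟩
    have hT : T ⊆ S := by simpa using hT
    beta_reduce at hy1 hy2 ⊢
    have split1 := Finset.sum_filter_add_sum_filter_not T (fun k => k + i < b) (fun k => 2 ^ k)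
    have split2 := Finset.sum_filter_add_sum_filter_not (T.filter fun k => k + i < b)
      (fun k => b ≤ k + j) (fun k => 2 ^ k)
    obtain ⟨q, hq⟩ := exists_sum_two_pow_div_eq (b := b) (i := i)
      (T := T.filter fun k => ¬ k + i < b) (fun k hk => by
        have := (Finset.mem_filter.1 hk).2; omega)
    have hlow := sum_two_pow_div_le (b := b) (j := i) (T := T.filter fun k => k + i < b)
      (fun k hk => (Finset.mem_filter.1 hk).2)
    have htail := sum_two_pow_div_le (b := b) (j := j)
      (T := (T.filter fun k => k + i < b).filter fun k => ¬ b ≤ k + j)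
      (fun k hk => by have := (Finset.mem_filter.1 hk).2; omega)
    rw [← split1, Nat.cast_add, add_div, hq] at hy1 hy2 ⊢
    have h0 : 0 ≤ ((∑ k ∈ T.filter (fun k => k + i < b), 2 ^ k : ℕ) : ℝ) / 2 ^ b := by positivity
    have hp : (0 : ℝ) < 2 ^ i := by positivity
    have hqz1 : z ≤ q := by
      rw [hz, Int.ceil_le]
      have : x - 1 / 2 ^ i ≤ (q : ℝ) / 2 ^ i := by linarith
      rw [le_div_iff₀ hp, sub_mul, one_div, inv_mul_cancel₀ hp.ne'] at this
      linarith
    have hqz2 : q ≤ z + 2 := by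
      have h1 : (q : ℝ) / 2 ^ i ≤ x + 1 / 2 ^ i := by linarith
      rw [div_le_iff₀ hp, add_mul, one_div, inv_mul_cancel₀ hp.ne'] at h1
      have h2 := Int.le_ceil (2 ^ i * x - 1)
      rw [← hz] at h2
      have : (q : ℝ) ≤ ((z + 2 : ℤ) : ℝ) := by push_cast; linarith
      exact_mod_cast this
    refine ⟨_, Finset.mem_image.2 ⟨(q, (T.filter fun k => k + i < b).filter fun k => b ≤ k + j),
      ?_, rfl⟩, ?_, ?_⟩
    · rw [Finset.mem_product, Finset.mem_Icc, Finset.mem_powerset]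
      refine ⟨⟨hqz1, hqz2⟩, fun k hk => ?_⟩
      simp only [Finset.mem_filter] at hk ⊢
      exact ⟨hT hk.1.1, hk.2, hk.1.2⟩
    · rw [← split2, Nat.cast_add, add_div]
      have : 0 ≤ ((∑ k ∈ (T.filter fun k => k + i < b).filter (fun k => ¬ b ≤ k + j),
        2 ^ k : ℕ) : ℝ) / 2 ^ b := by positivity
      linarith
    · rw [← split2, Nat.cast_add, add_div]
      linarith

lemma two_pow_card_le_coverNum_digitSet (b : ℕ) (S : Finset ℕ) :
    ((2 ^ S.card : ℕ) : ℕ∞) ≤ coverNum (digitSet b S) (1 / 2 ^ (b + 1)) := by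
  have hinj : Function.Injective
      (fun T : Finset ℕ => ((∑ k ∈ T, 2 ^ k : ℕ) : ℝ) / 2 ^ b) := by
    intro T T' h
    rw [div_left_inj' (by positivity), Nat.cast_inj] at h
    exact Finset.geomSum_injective le_rfl h
  have hcard : (digitSet b S).encard = ((2 ^ S.card : ℕ) : ℕ∞) := by
    rw [digitSet, hinj.encard_image, Set.encard_coe_eq_coe_finsetCard, Finset.card_powerset]
  rw [← hcard, coverNum]
  refine le_trans ?_ (Metric.packingNumber_two_mul_le_externalCoveringNumber _ _)
  refine Metric.IsSeparated.encard_le_packingNumber subset_rfl ?_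
  rintro _ ⟨T, -, rfl⟩ _ ⟨T', -, rfl⟩ hne
  rw [edist_dist, ← ENNReal.ofReal_coe_nnreal, ENNReal.ofReal_lt_ofReal_iff
    (dist_pos.2 hne), NNReal.coe_mul, Real.coe_toNNReal _ (by positivity), Real.dist_eq,
    ← sub_div, abs_div, abs_of_pos (by positivity : (0 : ℝ) < 2 ^ b)]
  have hne' : ((∑ k ∈ T, 2 ^ k : ℕ) : ℤ) - ((∑ k ∈ T', 2 ^ k : ℕ) : ℤ) ≠ 0 := by
    intro h
    apply hne
    have : (∑ k ∈ T, 2 ^ k : ℕ) = ∑ k ∈ T', 2 ^ k := by exact_mod_cast sub_eq_zero.1 h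
    simp only [this]
  have hone : (1 : ℝ) ≤ |((∑ k ∈ T, 2 ^ k : ℕ) : ℝ) - ((∑ k ∈ T', 2 ^ k : ℕ) : ℝ)| := by
    exact_mod_cast Int.one_le_abs hne'
  calc ((2 : ℝ≥0) : ℝ) * (1 / 2 ^ (b + 1) / 2) = 1 / 2 ^ (b + 1) := by
        push_cast; ring
    _ < 1 / 2 ^ b := by
        gcongr <;> norm_num
    _ ≤ _ := by gcongr

/-! ### Evenly spaced digits -/

/-- `m` evenly spaced elements of `{0, …, L - 1}`. -/
def positions (L m : ℕ) : Finset ℕ := (Finset.range m).image fun t => t * L / m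

lemma card_positions {L m : ℕ} (h : m ≤ L) : (positions L m).card = m := by
  rcases m.eq_zero_or_pos with rfl | hm
  · simp [positions]
  have hmono : StrictMono fun t => t * L / m := strictMono_nat_of_lt_succ fun t => by
    have : t * L + m ≤ (t + 1) * L := by nlinarith
    calc t * L / m < t * L / m + 1 := Nat.lt_succ_self _
      _ = (t * L + m) / m := (Nat.add_div_right _ hm).symm
      _ ≤ (t + 1) * L / m := Nat.div_le_div_right this
  rw [positions, Finset.card_image_of_injective _ hmono.injective, Finset.card_range]

lemma lt_of_mem_positions {L m k : ℕ} (h : m ≤ L) (hk : k ∈ positions L m) : k < L := by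
  obtain ⟨t, ht, rfl⟩ := Finset.mem_image.1 hk
  have ht := Finset.mem_range.1 ht
  rw [Nat.div_lt_iff_lt_mul (by omega), mul_comm L]
  exact Nat.mul_lt_mul_of_pos_right ht (by omega)

lemma card_filter_positions_mul_le (L m u v : ℕ) (huv : u ≤ v) :
    ((positions L m).filter fun k => u ≤ k ∧ k < v).card * L ≤ (v - u) * m + L := by
  rcases m.eq_zero_or_pos with rfl | hm
  · simp [positions]
  set A := (Finset.range m).filter fun t => u ≤ t * L / m ∧ t * L / m < v with hA
  have hle : ((positions L m).filter fun k => u ≤ k ∧ k < v).card ≤ A.card := by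
    rw [positions, Finset.filter_image]
    exact Finset.card_image_le
  refine (Nat.mul_le_mul_right L hle).trans ?_
  rcases A.eq_empty_or_nonempty with h | h
  · simp [h]
  have hmin := (Finset.mem_filter.1 (A.min'_mem h)).2.1
  have hmax := (Finset.mem_filter.1 (A.max'_mem h)).2.2
  rw [Nat.le_div_iff_mul_le hm] at hmin
  rw [Nat.div_lt_iff_lt_mul hm] at hmax
  have hmm := A.min'_le_max' h
  have hsub : A ⊆ Finset.Icc (A.min' h) (A.max' h) := fun t ht =>
    Finset.mem_Icc.2 ⟨A.min'_le t ht, A.le_max' t ht⟩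
  have hcard := Finset.card_le_card hsub
  rw [Nat.card_Icc] at hcard
  obtain ⟨d, hd⟩ := Nat.exists_eq_add_of_le hmm
  obtain ⟨w, rfl⟩ := Nat.exists_eq_add_of_le huv
  rw [hd] at hcard hmax
  have hcard : A.card ≤ d + 1 := by omega
  rw [Nat.add_sub_cancel_left]
  nlinarith [Nat.mul_le_mul_right L hcard]

lemma card_filter_positions_add_le {a b m i j : ℕ} {α t : ℝ} (hα : 0 ≤ α) (hαt : α ≤ t)
    (hab : a + m ≤ b) (habm : a * α + m ≤ b * t) (hij : i ≤ j) :
    (((positions (b - a) m).filter fun k => b ≤ k + j ∧ k + i < b).card : ℝ) + i * α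
      ≤ j * t + 1 := by
  have hij' : (i : ℝ) ≤ j := by exact_mod_cast hij
  have hi0 : (0 : ℝ) ≤ i := i.cast_nonneg
  have hj0 : (0 : ℝ) ≤ j := j.cast_nonneg
  have htriv : (i : ℝ) * α ≤ j * t := by nlinarith
  have hlt : ∀ k ∈ positions (b - a) m, k < b - a := fun k => lt_of_mem_positions (by omega)
  rcases Nat.eq_zero_or_pos (b - a) with hL | hL
  · have : ((positions (b - a) m).filter fun k => b ≤ k + j ∧ k + i < b) = ∅ := by
      refine Finset.filter_eq_empty_iff.2 fun k hk _ => ?_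
      have := hlt k hk
      omega
    rw [this]
    simp
    linarith
  rcases lt_or_ge (min j b) (max i a) with h | h
  · have : ((positions (b - a) m).filter fun k => b ≤ k + j ∧ k + i < b) = ∅ := by
      refine Finset.filter_eq_empty_iff.2 fun k hk _ => ?_
      have := hlt k hk
      omega
    rw [this]
    simp
    linarith
  obtain ⟨i', hi'⟩ : ∃ i', i' = max i a := ⟨_, rfl⟩
  obtain ⟨j', hj'⟩ : ∃ j', j' = min j b := ⟨_, rfl⟩
  have hsub : ((positions (b - a) m).filter fun k => b ≤ k + j ∧ k + i < b) ⊆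
      (positions (b - a) m).filter fun k => b - j' ≤ k ∧ k < b - i' := by
    intro k hk
    rw [Finset.mem_filter] at hk ⊢
    have := hlt k hk.1
    exact ⟨hk.1, by omega, by omega⟩
  have hcard := card_filter_positions_mul_le (b - a) m (b - j') (b - i') (by omega)
  have hcard' := (Nat.mul_le_mul_right (b - a) (Finset.card_le_card hsub)).trans hcard
  rw [show b - i' - (b - j') = j' - i' by omega] at hcard'
  generalize ((positions (b - a) m).filter fun k => b ≤ k + j ∧ k + i < b).card = n at hcard' ⊢
  have hL' : (0 : ℝ) < (b : ℝ) - a := by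
    have : (a : ℝ) < b := by exact_mod_cast (by omega : a < b)
    linarith
  have hcast : (n : ℝ) * (b - a) ≤ (j' - i') * m + (b - a) := by
    have : ((n * (b - a) : ℕ) : ℝ) ≤ (((j' - i') * m + (b - a) : ℕ) : ℝ) := by
      exact_mod_cast hcard'
    push_cast [Nat.cast_sub (by omega : a ≤ b), Nat.cast_sub (by omega : i' ≤ j')] at this
    exact this
  have h1 : (i : ℝ) ≤ i' := by exact_mod_cast (by omega : i ≤ i')
  have h2 : (j' : ℝ) ≤ j := by exact_mod_cast (by omega : j' ≤ j)
  have h3 : (a : ℝ) ≤ i' := by exact_mod_cast (by omega : a ≤ i')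
  have h4 : (j' : ℝ) ≤ b := by exact_mod_cast (by omega : j' ≤ b)
  have h5 : (i' : ℝ) ≤ j' := by exact_mod_cast (by omega : i' ≤ j')
  have ha0 : (0 : ℝ) ≤ a := a.cast_nonneg
  have hm0 : (0 : ℝ) ≤ m := m.cast_nonneg
  obtain ⟨s, hs⟩ : ∃ s : ℝ, s * (b - a) = m := ⟨m / (b - a), by field_simp⟩
  have hn : (n : ℝ) ≤ (j' - i') * s + 1 := by
    refine le_of_mul_le_mul_right ?_ hL'
    calc (n : ℝ) * (b - a) ≤ (j' - i') * m + (b - a) := hcast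
      _ = ((j' - i') * s + 1) * (b - a) := by rw [← hs]; ring
  have hkey : (j' - i') * s + i' * α ≤ j' * t := by
    have hj'0 : (0 : ℝ) ≤ j' := by linarith
    rcases le_total s α with hsα | hsα
    · have e1 : 0 ≤ (j' - i') * (α - s) := mul_nonneg (by linarith) (by linarith)
      have e2 : 0 ≤ j' * (t - α) := mul_nonneg hj'0 (by linarith)
      linarith
    · have e1 : 0 ≤ (i' - a) * (s - α) := mul_nonneg (by linarith) (by linarith)
      suffices 0 ≤ j' * (t - s) + a * (s - α) by linarith
      rcases le_total s t with hst | hst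
      · exact add_nonneg (mul_nonneg hj'0 (by linarith)) (mul_nonneg ha0 (by linarith))
      · have e2 : 0 ≤ (b - j') * (s - t) := mul_nonneg (by linarith) (by linarith)
        linarith
  have h6 : (i : ℝ) * α ≤ i' * α := mul_le_mul_of_nonneg_right h1 hα
  have h7 : (j' : ℝ) * t ≤ j * t := mul_le_mul_of_nonneg_right h2 (by linarith)
  linarith

/-! ### A set with prescribed Legendre-Assouad function -/

/-- The triple `(a, b, m)` encodes a line `θ α + c` below `τ`, with `θ = a / b` and `c = m / b`. -/
def Admissible (τ : ℝ≥0 → ℝ≥0) (a b m : ℕ) : Prop :=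
  b ≤ a ^ 2 ∧ ∀ α : ℝ≥0, (a : ℝ) * α + m ≤ b * τ α

/-- The union of the homogeneous sets in `[0, 2 ^ (-a)]` that have `2 ^ m` points at scale
`2 ^ (-b)`, over all admissible triples. -/
def realizingSet (τ : ℝ≥0 → ℝ≥0) : Set ℝ :=
  {x | ∃ a b m : ℕ, Admissible τ a b m ∧ x ∈ digitSet b (positions (b - a) m)}

section

variable {τ : ℝ≥0 → ℝ≥0}

lemma Admissible.add_le {a b m : ℕ} (h : Admissible τ a b m) (h1 : τ 1 = 1) : a + m ≤ b := by
  have := h.2 1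
  rw [h1] at this
  simp only [NNReal.coe_one, mul_one] at this
  exact_mod_cast this

lemma mem_Icc_of_mem_digitSet_positions {a b m : ℕ} (h : a + m ≤ b) {x : ℝ}
    (hx : x ∈ digitSet b (positions (b - a) m)) : x ∈ Icc (0 : ℝ) (1 / 2 ^ a) := by
  obtain ⟨T, hT, rfl⟩ := hx
  refine ⟨by positivity, sum_two_pow_div_le fun k hk => ?_⟩
  have hT : T ⊆ positions (b - a) m := by simpa using hT
  have := lt_of_mem_positions (by omega) (hT hk)
  omega

lemma realizingSet_subset (h1 : τ 1 = 1) : realizingSet τ ⊆ Icc 0 1 := by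
  rintro x ⟨a, b, m, h, hx⟩
  have := mem_Icc_of_mem_digitSet_positions (h.add_le h1) hx
  refine ⟨this.1, this.2.trans ?_⟩
  rw [div_le_one (by positivity)]
  exact one_le_pow₀ one_le_two

lemma realizingSet_nonempty : (realizingSet τ).Nonempty :=
  ⟨0, 0, 0, 0, ⟨by simp, by simp⟩, ∅, by simp, by simp⟩

lemma exists_cover_digitSet_positions (h1 : τ 1 = 1) {α : ℝ≥0} (hα : α ≤ τ α) {i j : ℕ}
    (hij : i ≤ j) (x : ℝ) (a b m : ℕ) :
    ∃ C : Finset ℝ, (C.card : ℝ) ≤ 6 * 2 ^ ((j : ℝ) * τ α - i * α) ∧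
      (Admissible τ a b m → ∀ y ∈ digitSet b (positions (b - a) m),
        y ∈ Icc x (x + 1 / 2 ^ i) → ∃ c ∈ C, c ≤ y ∧ y ≤ c + 1 / 2 ^ j) := by
  by_cases hadm : Admissible τ a b m
  · obtain ⟨C, hC, hcov⟩ := exists_cover_digitSet b (positions (b - a) m) i j x
    refine ⟨C, ?_, fun _ => hcov⟩
    have hexp := card_filter_positions_add_le (i := i) (j := j) α.coe_nonneg
      (NNReal.coe_le_coe.2 hα) (hadm.add_le h1) (hadm.2 α) hij
    set n := ((positions (b - a) m).filter fun k => b ≤ k + j ∧ k + i < b).card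
    calc (C.card : ℝ) ≤ 3 * 2 ^ n := by exact_mod_cast hC
      _ = 3 * (2 : ℝ) ^ (n : ℝ) := by rw [Real.rpow_natCast]
      _ ≤ 3 * (2 : ℝ) ^ ((j : ℝ) * τ α - i * α + 1) := by
          gcongr
          · norm_num
          · linarith
      _ = 6 * 2 ^ ((j : ℝ) * τ α - i * α) := by
          rw [Real.rpow_add two_pos, Real.rpow_one]
          ring
  · exact ⟨∅, by simp; positivity, fun h => absurd h hadm⟩

lemma exists_cover_realizingSet (h1 : τ 1 = 1) {α : ℝ≥0} (hα : α ≤ τ α) {i j : ℕ}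
    (hij : i ≤ j) (x : ℝ) :
    ∃ C : Finset ℝ, (C.card : ℝ) ≤
        1 + (j * ((j ^ 2 + 1) * (j ^ 2 + 1))) * (6 * 2 ^ ((j : ℝ) * τ α - i * α)) ∧
      ∀ y ∈ realizingSet τ ∩ Icc x (x + 1 / 2 ^ i), ∃ c ∈ C, c ≤ y ∧ y ≤ c + 1 / 2 ^ j := by
  choose C hC hcov using exists_cover_digitSet_positions h1 hα hij x
  set P : Finset (ℕ × ℕ × ℕ) :=
    Finset.range j ×ˢ Finset.range (j ^ 2 + 1) ×ˢ Finset.range (j ^ 2 + 1) with hP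
  refine ⟨insert 0 (P.biUnion fun p => C p.1 p.2.1 p.2.2), ?_, ?_⟩
  · have hins := Finset.card_insert_le (0 : ℝ) (P.biUnion fun p => C p.1 p.2.1 p.2.2)
    have hsum := Finset.card_biUnion_le (s := P) (t := fun p => C p.1 p.2.1 p.2.2)
    have hPcard : (P.card : ℝ) = j * ((j ^ 2 + 1) * (j ^ 2 + 1)) := by
      simp [hP, Finset.card_product]
    calc ((insert 0 (P.biUnion fun p => C p.1 p.2.1 p.2.2)).card : ℝ)
        ≤ 1 + ∑ p ∈ P, ((C p.1 p.2.1 p.2.2).card : ℝ) := by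
          exact_mod_cast (by omega : _ ≤ 1 + ∑ p ∈ P, (C p.1 p.2.1 p.2.2).card)
      _ ≤ 1 + P.card • (6 * (2 : ℝ) ^ ((j : ℝ) * τ α - i * α)) := by
          gcongr
          exact Finset.sum_le_card_nsmul _ _ _ fun p _ => hC _ _ _
      _ = _ := by rw [nsmul_eq_mul, hPcard]
  · rintro y ⟨⟨a, b, m, hadm, hy⟩, hyI⟩
    rcases lt_or_ge a j with haj | haj
    · obtain ⟨c, hc, hcy⟩ := hcov a b m hadm y hy hyI
      refine ⟨c, Finset.mem_insert_of_mem (Finset.mem_biUnion.2 ⟨(a, b, m), ?_, hc⟩), hcy⟩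
      have hb := hadm.1
      have hab := hadm.add_le h1
      have haj2 : a ^ 2 ≤ j ^ 2 := Nat.pow_le_pow_left haj.le 2
      simp only [hP, Finset.mem_product, Finset.mem_range]
      omega
    · have hmem := mem_Icc_of_mem_digitSet_positions (hadm.add_le h1) hy
      refine ⟨0, Finset.mem_insert_self _ _, hmem.1, hmem.2.trans ?_⟩
      rw [zero_add]
      gcongr
      norm_num

lemma exists_pow_le_mul_two_rpow {ε : ℝ} (hε : 0 < ε) :
    ∃ K : ℝ, 0 < K ∧ ∀ j : ℕ, ((j : ℝ) + 1) ^ 5 ≤ K * 2 ^ ((j : ℝ) * ε) := by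
  have hr : (1 : ℝ) < 2 ^ ε := Real.one_lt_rpow one_lt_two hε
  obtain ⟨K, hK0, hK⟩ := Asymptotics.bound_of_isBigO_nat_atTop
    (isLittleO_pow_const_const_pow_of_one_lt (R := ℝ) 5 hr).isBigO
  refine ⟨K * 2 ^ ε, by positivity, fun j => ?_⟩
  have h2 : ((2 : ℝ) ^ ε) ^ (j + 1) ≠ 0 := by positivity
  have := hK h2
  rw [Real.norm_of_nonneg (by positivity), Real.norm_of_nonneg (by positivity)] at this
  push_cast at this
  refine this.trans (le_of_eq ?_)
  rw [pow_succ, ← Real.rpow_natCast (2 ^ ε), ← Real.rpow_mul two_pos.le, mul_comm ε]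
  ring

theorem nuSharp_realizingSet_le (h1 : τ 1 = 1) {α : ℝ≥0} (hα : α ≤ τ α) :
    nuSharp (realizingSet τ) α ≤ ((τ α : ℝ) : EReal) := by
  refine EReal.le_of_forall_lt_iff_le.1 fun r hr => ?_
  have hr : (τ α : ℝ) < r := by exact_mod_cast hr
  obtain ⟨K, hK0, hK⟩ := exists_pow_le_mul_two_rpow (sub_pos.2 hr)
  have hr0 : 0 < r := (τ α).coe_nonneg.trans_lt hr
  have hα' : (α : ℝ) ≤ τ α := NNReal.coe_le_coe.2 hα
  refine nuSharp_le (C := 2 ^ (α : ℝ) * (6 * K) * 2 ^ r) ?_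
  filter_upwards [eventually_mem_Ioo_zero_one] with δ hδ
  obtain ⟨n, hn1, hn2⟩ := exists_nat_pow_near (one_le_one_div hδ.1 hδ.2.le) one_lt_two
  refine iSup_le fun l => iSup₂_le fun hl x => ?_
  have hl0 : 0 < l := hδ.1.trans_le hl.1
  obtain ⟨i, hi1, hi2⟩ := exists_nat_pow_near (one_le_one_div hl0 hl.2) one_lt_two
  have hij : i ≤ n + 1 := by
    refine (Nat.pow_lt_pow_iff_right (a := 2) one_lt_two).1 ?_ |>.le
    have : (2 : ℝ) ^ i < 2 ^ (n + 1) :=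
      hi1.trans_lt ((one_div_le_one_div_of_le hδ.1 hl.1).trans_lt hn2)
    exact_mod_cast this
  obtain ⟨j, hj⟩ : ∃ j, j = n + 1 := ⟨_, rfl⟩
  rw [← hj] at hij hn2
  have hδj : 1 / 2 ^ j ≤ δ := (one_div_lt hδ.1 (by positivity)).1 hn2 |>.le
  have hli : l ≤ 1 / 2 ^ i := (le_one_div (by positivity) hl0).1 hi1
  obtain ⟨C, hC, hcov⟩ := exists_cover_realizingSet h1 hα hij x
  have hN : (coverNum (realizingSet τ ∩ Icc x (x + l)) δ : ℝ≥0∞) ≤ ENNReal.ofReal (C.card : ℝ) := by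
    rw [ENNReal.ofReal_natCast, ← ENat.toENNReal_coe]
    have h2 : coverNum (realizingSet τ ∩ Icc x (x + l)) δ ≤ C.card :=
      (coverNum_anti _ hδj).trans (coverNum_le_card (by positivity) C fun y hy =>
        hcov y ⟨hy.1, hy.2.1, hy.2.2.trans (by linarith)⟩)
    exact_mod_cast h2
  refine (mul_le_mul_right hN _).trans ?_
  rw [← ENNReal.ofReal_mul (by positivity)]
  apply ENNReal.ofReal_le_ofReal
  have hlα : l ^ (-(α : ℝ)) ≤ 2 ^ (α : ℝ) * 2 ^ ((i : ℝ) * α) := by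
    calc l ^ (-(α : ℝ)) = (1 / l) ^ (α : ℝ) := by
          rw [one_div, Real.inv_rpow hl0.le, Real.rpow_neg hl0.le]
      _ ≤ ((2 : ℝ) ^ (i + 1)) ^ (α : ℝ) := by gcongr
      _ = 2 ^ (α : ℝ) * 2 ^ ((i : ℝ) * α) := by
          rw [← Real.rpow_natCast, ← Real.rpow_mul two_pos.le, ← Real.rpow_add two_pos]
          push_cast
          ring_nf
  have hij' : (i : ℝ) ≤ j := by exact_mod_cast hij
  have hj0 : (0 : ℝ) ≤ j := j.cast_nonneg
  have hone : (1 : ℝ) ≤ 2 ^ ((j : ℝ) * τ α - i * α) := by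
    refine Real.one_le_rpow one_le_two ?_
    have e1 : (i : ℝ) * α ≤ j * α := mul_le_mul_of_nonneg_right hij' α.coe_nonneg
    have e2 : (j : ℝ) * α ≤ j * τ α := mul_le_mul_of_nonneg_left hα' hj0
    linarith
  have hpoly : 1 + (j * (((j : ℝ) ^ 2 + 1) * (j ^ 2 + 1))) * (6 * 2 ^ ((j : ℝ) * τ α - i * α))
      ≤ 6 * (j + 1) ^ 5 * 2 ^ ((j : ℝ) * τ α - i * α) := by
    set Q : ℝ := 2 ^ ((j : ℝ) * τ α - i * α)
    have e : 1 + 6 * (j * (((j : ℝ) ^ 2 + 1) * (j ^ 2 + 1))) ≤ 6 * (j + 1) ^ 5 := by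
      have : (6 * ((j : ℝ) + 1) ^ 5) - (1 + 6 * (j * ((j ^ 2 + 1) * (j ^ 2 + 1))))
        = 30 * j ^ 4 + 48 * j ^ 3 + 60 * j ^ 2 + 24 * j + 5 := by ring
      have : (0 : ℝ) ≤ 30 * (j : ℝ) ^ 4 + 48 * j ^ 3 + 60 * j ^ 2 + 24 * j + 5 := by positivity
      linarith
    calc 1 + (j * (((j : ℝ) ^ 2 + 1) * (j ^ 2 + 1))) * (6 * Q)
        ≤ Q + (j * (((j : ℝ) ^ 2 + 1) * (j ^ 2 + 1))) * (6 * Q) := by linarith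
      _ = (1 + 6 * (j * (((j : ℝ) ^ 2 + 1) * (j ^ 2 + 1)))) * Q := by ring
      _ ≤ 6 * (j + 1) ^ 5 * Q := by gcongr
  have h2j : (2 : ℝ) ^ (j : ℝ) ≤ 2 * δ⁻¹ := by
    rw [Real.rpow_natCast, hj, pow_succ, mul_comm]
    rw [one_div] at hn1
    linarith
  calc l ^ (-(α : ℝ)) * C.card
      ≤ (2 ^ (α : ℝ) * 2 ^ ((i : ℝ) * α)) *
          (6 * (K * 2 ^ ((j : ℝ) * (r - τ α))) * 2 ^ ((j : ℝ) * τ α - i * α)) := by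
        refine mul_le_mul hlα (hC.trans (hpoly.trans ?_)) (by positivity) (by positivity)
        have := hK j
        gcongr
    _ = 2 ^ (α : ℝ) * (6 * K) * (2 ^ ((i : ℝ) * α) * 2 ^ ((j : ℝ) * (r - τ α)) *
          2 ^ ((j : ℝ) * τ α - i * α)) := by ring
    _ = 2 ^ (α : ℝ) * (6 * K) * ((2 : ℝ) ^ (j : ℝ)) ^ r := by
        rw [← Real.rpow_add two_pos, ← Real.rpow_add two_pos, ← Real.rpow_mul two_pos.le]
        ring_nf
    _ ≤ 2 ^ (α : ℝ) * (6 * K) * (2 * δ⁻¹) ^ r := by gcongr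
    _ = 2 ^ (α : ℝ) * (6 * K) * 2 ^ r * δ ^ (-r) := by
        rw [Real.mul_rpow two_pos.le (inv_nonneg.2 hδ.1.le), Real.inv_rpow hδ.1.le,
          Real.rpow_neg hδ.1.le]
        ring

/-! ### Lower bounds from supporting lines -/

lemma admissible_floor {θ c : ℝ} (hθ0 : 0 < θ) (hθ1 : θ ≤ 1) (hc : 0 ≤ c)
    (hline : ∀ α : ℝ≥0, θ * α + c ≤ τ α) {b : ℕ} (hb : 4 / θ ^ 2 ≤ b) :
    Admissible τ ⌊θ * b⌋₊ b ⌊c * b⌋₊ := by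
  have hb0 : (0 : ℝ) ≤ b := b.cast_nonneg
  rw [div_le_iff₀ (by positivity)] at hb
  refine ⟨?_, fun α => ?_⟩
  · have hθb : 4 ≤ θ * b := by nlinarith [mul_nonneg hθ0.le hb0]
    have h1 : θ * b / 2 ≤ (⌊θ * b⌋₊ : ℝ) := by linarith [Nat.lt_floor_add_one (θ * b)]
    have h2 : (θ * b / 2) ^ 2 ≤ (⌊θ * b⌋₊ : ℝ) ^ 2 := by gcongr
    have h3 : (b : ℝ) ≤ (θ * b / 2) ^ 2 := by nlinarith
    exact_mod_cast h3.trans h2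
  · have h1 := Nat.floor_le (mul_nonneg hθ0.le hb0)
    have h2 := Nat.floor_le (mul_nonneg hc hb0)
    calc (⌊θ * b⌋₊ : ℝ) * α + ⌊c * b⌋₊ ≤ θ * b * α + c * b := by gcongr
      _ = b * (θ * α + c) := by ring
      _ ≤ b * τ α := by gcongr; exact hline α

lemma tendsto_one_div_two_pow_succ :
    Tendsto (fun b : ℕ => (1 : ℝ) / 2 ^ (b + 1)) atTop (𝓝[>] 0) := by
  refine tendsto_nhdsWithin_iff.2 ⟨?_, Eventually.of_forall fun b => by
    simp only [mem_Ioi]; positivity⟩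
  have := (tendsto_pow_atTop_nhds_zero_of_lt_one (r := (1 / 2 : ℝ)) (by norm_num)
    (by norm_num)).comp (tendsto_add_atTop_nat 1)
  refine this.congr fun b => ?_
  simp

lemma line_le_nuSharp_realizingSet (h1 : τ 1 = 1) {θ c : ℝ} (hθ0 : 0 < θ) (hθ1 : θ ≤ 1)
    (hc : 0 ≤ c) (hline : ∀ α : ℝ≥0, θ * α + c ≤ τ α) (α : ℝ≥0) :
    ((θ * α + c : ℝ) : EReal) ≤ nuSharp (realizingSet τ) α := by
  refine le_nuSharp (c := 2 ^ (-(θ * α + c + α + 1))) (by positivity) ?_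
  refine tendsto_one_div_two_pow_succ.frequently (Eventually.frequently ?_)
  obtain ⟨b₀, hb₀⟩ := exists_nat_ge (4 / θ ^ 2)
  filter_upwards [eventually_ge_atTop b₀] with b hb
  have hadm := admissible_floor hθ0 hθ1 hc hline (hb₀.trans (by exact_mod_cast hb : (b₀ : ℝ) ≤ b))
  have ha := Nat.lt_floor_add_one (θ * b)
  have hm := Nat.lt_floor_add_one (c * b)
  set a := ⌊θ * b⌋₊
  set m := ⌊c * b⌋₊
  have habm := hadm.add_le h1
  have hN : ((2 ^ m : ℕ) : ℕ∞) ≤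
      coverNum (realizingSet τ ∩ Icc 0 (0 + 1 / 2 ^ a)) (1 / 2 ^ (b + 1)) := by
    have := two_pow_card_le_coverNum_digitSet b (positions (b - a) m)
    rw [card_positions (by omega)] at this
    refine this.trans (coverNum_mono ?_ _)
    intro y hy
    rw [zero_add]
    exact ⟨⟨a, b, m, hadm, hy⟩, mem_Icc_of_mem_digitSet_positions habm hy⟩
  have hla : (1 : ℝ) / 2 ^ (b + 1) ≤ 1 / 2 ^ a := by
    gcongr
    · norm_num
    · omega
  have hla1 : (1 : ℝ) / 2 ^ a ≤ 1 := by
    rw [div_le_one (by positivity)]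
    exact one_le_pow₀ one_le_two
  refine le_trans ?_ (le_weightedSup (realizingSet τ) α hla hla1 0)
  have hN' : ENNReal.ofReal (2 ^ m) ≤
      (coverNum (realizingSet τ ∩ Icc 0 (0 + 1 / 2 ^ a)) (1 / 2 ^ (b + 1)) : ℝ≥0∞) := by
    have : ENNReal.ofReal (2 ^ m) = (((2 ^ m : ℕ) : ℕ∞) : ℝ≥0∞) := by
      rw [ENat.toENNReal_coe, ← ENNReal.ofReal_natCast]
      push_cast
      rfl
    rw [this]
    exact_mod_cast hN
  refine le_trans ?_ (mul_le_mul_right hN' _)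
  rw [← ENNReal.ofReal_mul (by positivity)]
  apply ENNReal.ofReal_le_ofReal
  have hpow : ∀ (n : ℕ) (s : ℝ), ((1 : ℝ) / 2 ^ n) ^ (-s) = 2 ^ ((n : ℝ) * s) := fun n s => by
    rw [one_div, ← Real.rpow_natCast, ← Real.rpow_neg two_pos.le, ← Real.rpow_mul two_pos.le]
    ring_nf
  rw [hpow, hpow, ← Real.rpow_natCast 2 m, ← Real.rpow_add two_pos, ← Real.rpow_add two_pos]
  refine Real.rpow_le_rpow_of_exponent_le one_le_two ?_
  have h3 : (θ * b - 1) * α ≤ a * α := mul_le_mul_of_nonneg_right (by linarith) α.coe_nonneg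
  push_cast
  nlinarith

/-! ### Supporting lines of convex functions -/

lemma three_point_inequality (hconv : ConvexOn ℝ≥0 univ τ)
    {x y z : ℝ≥0} (hxy : x < y) (hyz : y < z) :
    ((z : ℝ) - x) * τ y ≤ (z - y) * τ x + (y - x) * τ z := by
  have hxz : 0 < z - x := tsub_pos_of_lt (hxy.trans hyz)
  have hzy : ((z - y : ℝ≥0) : ℝ) = z - y := NNReal.coe_sub hyz.le
  have hyx : ((y - x : ℝ≥0) : ℝ) = y - x := NNReal.coe_sub hxy.le
  have hzx : ((z - x : ℝ≥0) : ℝ) = z - x := NNReal.coe_sub (hxy.trans hyz).le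
  have hpos : (0 : ℝ) < z - x := by rw [← hzx]; exact_mod_cast hxz
  have hab : (z - y) / (z - x) + (y - x) / (z - x) = 1 := by
    rw [← NNReal.coe_inj]
    push_cast
    rw [hzy, hyx, hzx]
    field_simp
    ring
  have h := hconv.2 (mem_univ x) (mem_univ z) (zero_le (a := (z - y) / (z - x)))
    (zero_le (a := (y - x) / (z - x))) hab
  have hy : ((z - y) / (z - x)) • x + ((y - x) / (z - x)) • z = y := by
    rw [← NNReal.coe_inj]
    simp only [smul_eq_mul]
    push_cast
    rw [hzy, hyx, hzx]
    field_simp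
    ring
  rw [hy, ← NNReal.coe_le_coe] at h
  simp only [smul_eq_mul] at h
  push_cast at h
  rw [hzy, hyx, hzx] at h
  calc ((z : ℝ) - x) * τ y
      ≤ (z - x) * ((z - y) / (z - x) * τ x + (y - x) / (z - x) * τ z) := by gcongr
    _ = (z - y) * τ x + (y - x) * τ z := by field_simp

lemma le_of_convexOn_of_eq_self (hconv : ConvexOn ℝ≥0 univ τ)
    (hid : ∀ α : ℝ≥0, 1 ≤ α → τ α = α)
    (α : ℝ≥0) : α ≤ τ α := by
  rcases lt_or_ge α 1 with h | h
  · have := three_point_inequality hconv h one_lt_two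
    rw [hid 1 le_rfl, hid 2 one_le_two] at this
    rw [← NNReal.coe_le_coe]
    push_cast at this
    linarith
  · exact (hid α h).ge

lemma exists_supporting_line (hmono : Monotone τ) (hconv : ConvexOn ℝ≥0 univ τ)
    (hid : ∀ α : ℝ≥0, 1 ≤ α → τ α = α)
    (α₀ : ℝ≥0) :
    ∃ θ c : ℝ, 0 ≤ θ ∧ θ ≤ 1 ∧ 0 ≤ c ∧ (∀ α : ℝ≥0, θ * α + c ≤ τ α) ∧ θ * α₀ + c = τ α₀ := by
  have hle := le_of_convexOn_of_eq_self hconv hid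
  have hle₀ : (α₀ : ℝ) ≤ τ α₀ := hle α₀
  set A : Set ℝ := Set.image (fun y : ℝ≥0 => ((τ y : ℝ) - τ α₀) / (y - α₀)) (Ioi α₀) with hA
  have hA0 : ∀ s ∈ A, 0 ≤ s := by
    rintro _ ⟨y, hy, rfl⟩
    have h1 : (α₀ : ℝ) < y := NNReal.coe_lt_coe.2 hy
    have h2 : (τ α₀ : ℝ) ≤ τ y := NNReal.coe_le_coe.2 (hmono (le_of_lt hy))
    exact div_nonneg (by linarith) (by linarith)
  have hbdd : BddBelow A := ⟨0, hA0⟩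
  have hne : A.Nonempty := ⟨_, α₀ + 1, by simp, rfl⟩
  have hθ1 : sInf A ≤ 1 := by
    refine (csInf_le hbdd ⟨α₀ + 1, by simp, rfl⟩).trans ?_
    beta_reduce
    rw [hid (α₀ + 1) (by simp)]
    push_cast
    rw [add_sub_cancel_left, div_one]
    linarith
  refine ⟨sInf A, τ α₀ - sInf A * α₀, le_csInf hne hA0, hθ1, ?_, fun α => ?_, by ring⟩
  · nlinarith [α₀.coe_nonneg]
  rcases lt_trichotomy α α₀ with h | rfl | h
  · have h' : (α : ℝ) < α₀ := NNReal.coe_lt_coe.2 h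
    have hslope : ((τ α₀ : ℝ) - τ α) / (α₀ - α) ≤ sInf A := by
      refine le_csInf hne ?_
      rintro _ ⟨y, hy, rfl⟩
      have hy' : (α₀ : ℝ) < y := NNReal.coe_lt_coe.2 hy
      rw [div_le_div_iff₀ (by linarith) (by linarith)]
      linarith [three_point_inequality hconv h hy]
    rw [div_le_iff₀ (by linarith)] at hslope
    linarith
  · linarith
  · have h' : (α₀ : ℝ) < α := NNReal.coe_lt_coe.2 h
    have hslope : sInf A ≤ ((τ α : ℝ) - τ α₀) / (α - α₀) := csInf_le hbdd ⟨α, h, rfl⟩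
    rw [le_div_iff₀ (by linarith)] at hslope
    linarith

theorem le_nuSharp_realizingSet (hmono : Monotone τ) (hconv : ConvexOn ℝ≥0 univ τ)
    (hid : ∀ α : ℝ≥0, 1 ≤ α → τ α = α)
    (α : ℝ≥0) :
    ((τ α : ℝ) : EReal) ≤ nuSharp (realizingSet τ) α := by
  obtain ⟨θ, c, hθ0, hθ1, hc, hline, heq⟩ := exists_supporting_line hmono hconv hid α
  have hle := le_of_convexOn_of_eq_self hconv hid
  refine EReal.ge_of_forall_gt_iff_ge.1 fun r hr => ?_
  have hr : r < τ α := by exact_mod_cast hr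
  obtain ⟨η, hη0, hη1, hη⟩ : ∃ η : ℝ, 0 < η ∧ η ≤ 1 ∧ r ≤ (1 - η) * τ α + η * α := by
    have hα : (0 : ℝ) ≤ τ α - α := sub_nonneg.2 (hle α)
    refine ⟨min 1 ((τ α - r) / (τ α - α + 1)), ?_, min_le_left _ _, ?_⟩
    · exact lt_min one_pos (div_pos (by linarith) (by linarith))
    · have h2 := min_le_right 1 ((τ α - r) / (τ α - α + 1))
      have h0 : 0 < min 1 ((τ α - r) / (τ α - α + 1)) :=
        lt_min one_pos (div_pos (by linarith) (by linarith))
      rw [le_div_iff₀ (by linarith)] at h2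
      nlinarith
  refine le_trans ?_ (line_le_nuSharp_realizingSet (hid 1 le_rfl) (θ := (1 - η) * θ + η)
    (c := (1 - η) * c) ?_ ?_ ?_ (fun β => ?_) α)
  · rw [EReal.coe_le_coe_iff]
    rw [← heq] at hη
    linarith
  · nlinarith
  · nlinarith
  · exact mul_nonneg (by linarith) hc
  · have h1 := mul_le_mul_of_nonneg_left (hline β) (by linarith : 0 ≤ 1 - η)
    have h2 := mul_le_mul_of_nonneg_left (NNReal.coe_le_coe.2 (hle β)) hη0.le
    linarith

theorem nuSharp_realizingSet (hmono : Monotone τ) (hconv : ConvexOn ℝ≥0 univ τ)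
    (hid : ∀ α : ℝ≥0, 1 ≤ α → τ α = α)
    (α : ℝ≥0) :
    nuSharp (realizingSet τ) α = ((τ α : ℝ) : EReal) :=
  le_antisymm
    (nuSharp_realizingSet_le (hid 1 le_rfl) (le_of_convexOn_of_eq_self hconv hid α))
    (le_nuSharp_realizingSet hmono hconv hid α)

end

end LegendreAssouad

theorem theorem1p2 :
    (∀ E : Set ℝ, Bornology.IsBounded E → E.Nonempty → ∀ α : ℝ,
      LegendreAssouad.nuSharp E α
          = LegendreAssouad.legendreTransform (Set.Icc 0 1) (LegendreAssouad.nu E) α ∧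
        LegendreAssouad.nuSharp E α ≠ ⊥ ∧ LegendreAssouad.nuSharp E α ≠ ⊤) ∧
    (∀ τ : ℝ≥0 → ℝ≥0,
      (∃ E : Set ℝ, Bornology.IsBounded E ∧ E.Nonempty ∧
        ∀ α : ℝ≥0, LegendreAssouad.nuSharp E (α : ℝ) = ((τ α : ℝ) : EReal)) ↔
      (Monotone τ ∧ ConvexOn ℝ≥0 Set.univ τ ∧ ∀ α : ℝ≥0, 1 ≤ α → τ α = α)) := by
  refine ⟨fun E _ hE α => ⟨LegendreAssouad.nuSharp_eq_legendreTransform hE α,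
    LegendreAssouad.nuSharp_ne_bot_top hE α⟩, fun τ => ⟨?_, ?_⟩⟩
  · rintro ⟨E, -, hE, h⟩
    exact ⟨LegendreAssouad.monotone_of_nuSharp_eq hE h,
      LegendreAssouad.convexOn_of_nuSharp_eq hE h,
      fun α hα => LegendreAssouad.eq_self_of_nuSharp_eq hE h hα⟩
  · rintro ⟨hmono, hconv, hid⟩
    exact ⟨LegendreAssouad.realizingSet τ,
      (Metric.isBounded_Icc 0 1).subset (LegendreAssouad.realizingSet_subset (hid 1 le_rfl)),
      LegendreAssouad.realizingSet_nonempty,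
      LegendreAssouad.nuSharp_realizingSet hmono hconv hid⟩
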